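/- Let $(\mathcal V,\otimes,I,\tau)$ be a braided monoidal category and let $\mathcal A=(A,m,e)$ be an algebra (monoid) in $\mathcal V$; associativity and unit constraints are suppressed. Write $F=A\otimes-$ for the monad on $\mathcal V$ with multiplication $m\otimes-$ and unit $e\otimes-$. The braiding gives a natural transformation $\lambda=\tau_{A,A}\otimes-\colon FF\to FF$, which is a monad distributive law satisfying the Yang--Baxter equation. Let $F^\lambda$ be the opposite monad, with the same functor and unit as $F$ and with multiplication $m\tau_{A,A}\otimes-$, and let $FF^\lambda$ be the composite monad defined by the distributive law $\lambda\colon F^\lambda F\to FF^\lambda$ (so that the $FF^\lambda$-modules are the left modules over the braided tensor product $\mathcal A\otimes\mathcal A^{\tau}$, where $\mathcal A^\tau=(A,m\tau_{A,A},e)$). Call $\mathcal A$ *left Azumaya* if the comparison functor $$\overline K_l\colon\mathcal V\to\mathcal V_{FF^\lambda},\qquad V\mapsto\bigl(A\otimes V,\ A\otimes A\otimes A\otimes V\xrightarrow{A\otimes m\tau_{A,A}\otimes V}A\otimes A\otimes V\xrightarrow{m\otimes V}A\otimes V\bigr)$$ into the Eilenberg--Moore category of $FF^\lambda$ is an equivalence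 of categories. If $\mathcal A$ is left Azumaya, then $A$ is finite in $\mathcal V$, i.e. $A$ has a left dual: there are an object $A^*$ and morphisms $\mathrm{db}\colon I\to A\otimes A^*$ and $\mathrm{ev}\colon A^*\otimes A\to I$ such that the composites $A\xrightarrow{\mathrm{db}\otimes A}A\otimes A^*\otimes A\xrightarrow{A\otimes\mathrm{ev}}A$ and $A^*\xrightarrow{A^*\otimes\mathrm{db}}A^*\otimes A\otimes A^*\xrightarrow{\mathrm{ev}\otimes A^*}A^*$ are identities. -/

import Mathlib

open CategoryTheory MonoidalCategory

namespace Azumaya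

universe v u

section Monads

variable {C : Type u} [Category.{v} C]

/-- A (monad) distributive law of the monad `T` over the monad `S`: a natural transformation
with components `T (S X) ⟶ S (T X)`, compatible with the units and the multiplications. -/
structure DistribLaw (T S : Monad C) where
  law : S.toFunctor ⋙ T.toFunctor ⟶ T.toFunctor ⋙ S.toFunctor
  unit_left : ∀ X : C,
    T.η.app (S.obj X) ≫ law.app X = S.map (T.η.app X)
  unit_right : ∀ X : C,
    T.map (S.η.app X) ≫ law.app X = S.η.app (T.obj X)
  mul_right : ∀ X : C,
    T.map (S.μ.app X) ≫ law.app X =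
      law.app (S.obj X) ≫ S.map (law.app X) ≫ S.μ.app (T.obj X)
  mul_left : ∀ X : C,
    T.μ.app (S.obj X) ≫ law.app X =
      T.map (law.app X) ≫ law.app (T.obj X) ≫ S.map (T.μ.app X)

/-- The composite monad `S T` (with underlying functor `X ↦ S (T X)`) defined by a distributive
law `T S ⟶ S T`; its multiplication is `S T S T ⟶ S S T T ⟶ S T`. -/
def DistribLaw.composite {T S : Monad C} (l : DistribLaw T S) : Monad C where
  toFunctor := T.toFunctor ⋙ S.toFunctor
  η :=
    { app := fun X => T.η.app X ≫ S.η.app (T.obj X)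
      naturality := fun X Y f => by
        have h1 := T.η.naturality f
        have h2 := S.η.naturality (T.map f)
        simp only [Functor.id_obj, Functor.id_map, Functor.comp_map] at h1 h2 ⊢
        rw [← Category.assoc, h1, Category.assoc, h2, Category.assoc] }
  μ :=
    { app := fun X => S.map (l.law.app (T.obj X)) ≫ S.μ.app (T.obj (T.obj X)) ≫
        S.map (T.μ.app X)
      naturality := fun X Y f => by
        have h1 := l.law.naturality (T.map f)
        have h2 := S.μ.naturality (T.map (T.map f))
        have h3 := T.μ.naturality f
        simp only [Functor.comp_obj, Functor.comp_map] at h1 h2 h3 ⊢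
        rw [← Category.assoc, ← S.map_comp, h1, S.map_comp, Category.assoc, ← Category.assoc
          (S.map (S.map (T.map (T.map f)))), h2]
        simp only [Category.assoc]
        rw [← S.map_comp, h3, S.map_comp] }
  assoc := fun X => by
    have h1 := congrArg S.map (l.mul_left (T.obj X))
    have h2 := congrArg S.map (l.mul_right (T.obj (T.obj X)))
    have n1 := congrArg S.map (l.law.naturality (T.μ.app X))
    have n2 := congrArg S.map (l.law.naturality (l.law.app (T.obj X)))
    have m1 := S.μ.naturality (T.map (T.μ.app X))
    have m2 := S.μ.naturality (T.map (l.law.app (T.obj X)))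
    have m3 := S.μ.naturality (l.law.app (T.obj (T.obj X)))
    have m4 := S.μ.naturality (S.map (T.μ.app (T.obj X)))
    have m5 := S.μ.naturality (T.μ.app (T.obj X))
    have a1 := S.assoc (T.obj (T.obj (T.obj X)))
    have a2 := congrArg S.map (T.assoc X)
    simp only [Functor.comp_obj, Functor.comp_map, Functor.map_comp, Category.assoc] at *
    rw [reassoc_of% n1, reassoc_of% h2, reassoc_of% n2, reassoc_of% m1, reassoc_of% a1, a2,
      reassoc_of% h1, ← reassoc_of% m2, ← reassoc_of% m3, reassoc_of% m5]
  left_unit := fun X => by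
    have h1 := congrArg S.map (l.unit_left (T.obj X))
    have n1 := S.η.naturality (T.η.app (S.obj (T.obj X)))
    have n2 := S.η.naturality (l.law.app (T.obj X))
    have m1 := S.μ.naturality (T.η.app (T.obj X))
    have a1 := S.left_unit (T.obj X)
    have a2 := congrArg S.map (T.left_unit X)
    simp only [Functor.comp_obj, Functor.comp_map, Functor.id_obj, Functor.id_map,
      Functor.map_comp, Functor.map_id, Category.assoc] at *
    rw [reassoc_of% n1, reassoc_of% h1, reassoc_of% m1, a2, S.map_id]
    simp
  right_unit := fun X => by
    have h1 := congrArg S.map (l.unit_right (T.obj X))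
    have a1 := S.right_unit (T.obj (T.obj X))
    have a2 := congrArg S.map (T.right_unit X)
    simp only [Functor.comp_obj, Functor.comp_map, Functor.id_obj, Functor.id_map,
      Functor.map_comp, Functor.map_id, Category.assoc] at *
    rw [reassoc_of% h1, reassoc_of% a1, a2, S.map_id]

/-- A (monad) BD-law on a monad `F`: a distributive law `F F ⟶ F F` of `F` over itself that
satisfies the Yang-Baxter equation. -/
structure BDLaw (F : Monad C) extends DistribLaw F F where
  yang_baxter : ∀ X : C,
    F.map (law.app X) ≫ law.app (F.obj X) ≫ F.map (law.app X) =
      law.app (F.obj X) ≫ F.map (law.app X) ≫ law.app (F.obj X)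

namespace BDLaw

variable {F : Monad C} (l : BDLaw F)

/-- The opposite monad `F^λ` : the same functor and unit, with multiplication `m · λ`. -/
def opposite : Monad C where
  toFunctor := F.toFunctor
  η := F.η
  μ := l.law ≫ F.μ
  assoc := fun X => by
    have h := l.mul_right X
    have h' := l.mul_left X
    have y := l.yang_baxter X
    have n := F.assoc X
    simp only [NatTrans.comp_app, Functor.comp_obj, Functor.map_comp, Category.assoc] at *
    rw [reassoc_of% h, reassoc_of% y, ← n, reassoc_of% h']
  left_unit := fun X => by
    have h := l.unit_left X
    have n := F.right_unit X
    simp only [NatTrans.comp_app, Functor.comp_obj] at *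
    rw [reassoc_of% h, n]
    rfl
  right_unit := fun X => by
    have h := l.unit_right X
    have n := F.left_unit X
    simp only [NatTrans.comp_app, Functor.comp_obj] at *
    rw [reassoc_of% h, n]
    rfl

/-- The BD-law `λ`, regarded as a distributive law `F^λ F ⟶ F F^λ`. -/
def oppositeDistribLaw : DistribLaw l.opposite F where
  law := l.law
  unit_left := l.unit_left
  unit_right := l.unit_right
  mul_right := l.mul_right
  mul_left := fun X => by
    have h := l.mul_left X
    have y := l.yang_baxter X
    simp only [opposite, NatTrans.comp_app, Functor.comp_obj, Functor.map_comp,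
      Category.assoc] at *
    rw [h, reassoc_of% y]

/-- The monad `F F^λ`. -/
def enveloping : Monad C := l.oppositeDistribLaw.composite

/-- The comparison functor from the base category to the Eilenberg-Moore category of `F F^λ`,
`X ↦ (F X, m · F m · F λ : F F F X ⟶ F X)`. -/
def comparison : C ⥤ l.enveloping.Algebra where
  obj X :=
    { A := F.obj X
      a := F.map (l.law.app X) ≫ F.map (F.μ.app X) ≫ F.μ.app X
      unit := by
        have h := congrArg F.map (l.unit_left X)
        have n := F.η.naturality (F.η.app (F.obj X))
        have n2 := F.η.naturality (l.law.app X)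
        have u1 := congrArg F.map (F.right_unit X)
        have u2 := F.left_unit X
        simp only [enveloping, DistribLaw.composite, oppositeDistribLaw, opposite,
          Functor.comp_obj, Functor.comp_map, Functor.id_obj, Functor.id_map,
          Functor.map_comp, Functor.map_id, Category.assoc] at *
        rw [reassoc_of% n, reassoc_of% h, reassoc_of% u1, F.map_id, Category.id_comp, u2]
      assoc := by
        have h1 := congrArg F.map (l.mul_left X)
        have h2 := congrArg F.map (congrArg F.map (l.mul_right X))
        have h3 := congrArg F.map (l.mul_right X)
        have y := congrArg F.map (congrArg F.map (l.yang_baxter X))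
        have n1 := congrArg F.map (l.law.naturality (l.law.app X))
        have n2 := congrArg F.map (l.law.naturality (F.μ.app X))
        have a1 := congrArg F.map (F.assoc X)
        have a2 := F.assoc X
        have m1 := F.μ.naturality (l.law.app (F.obj X))
        have m2 := F.μ.naturality (F.map (l.law.app X))
        have m3 := F.μ.naturality (F.μ.app (F.obj X))
        have m4 := F.μ.naturality (F.μ.app X)
        simp only [enveloping, DistribLaw.composite, oppositeDistribLaw, opposite,
          NatTrans.comp_app, Functor.comp_obj, Functor.comp_map, Functor.map_comp,
          Category.assoc] at *
        rw [reassoc_of% h1, reassoc_of% a1, ← reassoc_of% m1, ← reassoc_of% m2,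
          ← reassoc_of% m1, ← reassoc_of% m3, ← reassoc_of% m4,
          reassoc_of% h3, reassoc_of% n2, reassoc_of% n1, reassoc_of% h2, reassoc_of% y,
          ← reassoc_of% a1, a2] }
  map f :=
    { f := F.map f
      h := by
        have h := congrArg F.map (l.law.naturality f)
        have n := congrArg F.map (F.μ.naturality f)
        have m := F.μ.naturality f
        simp only [enveloping, DistribLaw.composite, oppositeDistribLaw, opposite,
          Functor.comp_obj, Functor.comp_map, Functor.map_comp, Category.assoc] at *
        rw [reassoc_of% h, reassoc_of% n, m] }
  map_id X := by
    ext
    exact F.map_id X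
  map_comp f g := by
    ext
    exact F.map_comp f g

end BDLaw

end Monads

section Algebras

variable {V : Type u} [Category.{v} V] [MonoidalCategory V]

/-- The monad `A ⊗ -` of an algebra `A`. -/
def leftMonad (A : V) [MonObj A] : Monad V where
  toFunctor := tensorLeft A
  η :=
    { app := fun X => (λ_ X).inv ≫ (MonObj.one : 𝟙_ V ⟶ A) ▷ X
      naturality := fun X Y f => by
        simp [← whisker_exchange] }
  μ :=
    { app := fun X => (α_ A A X).inv ≫ (MonObj.mul : A ⊗ A ⟶ A) ▷ X
      naturality := fun X Y f => by
        simp [← whisker_exchange] }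
  assoc := fun X => by
    have h := congrArg (fun f => f ▷ X) (MonObj.mul_assoc A)
    simp only [comp_whiskerRight] at h
    simp [h]
  left_unit := fun X => by
    have h := congrArg (fun f => f ▷ X) (MonObj.one_mul A)
    simp only [comp_whiskerRight] at h
    simp [h]
  right_unit := fun X => by
    change A ◁ ((λ_ X).inv ≫ (MonObj.one : 𝟙_ V ⟶ A) ▷ X) ≫ (α_ A A X).inv ≫ (MonObj.mul : A ⊗ A ⟶ A) ▷ X = 𝟙 (A ⊗ X)
    trans A ◁ (λ_ X).inv ≫ (α_ A (𝟙_ V) X).inv ≫ (A ◁ (MonObj.one : 𝟙_ V ⟶ A) ≫ (MonObj.mul : A ⊗ A ⟶ A)) ▷ X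
    · monoidal
    · rw [MonObj.mul_one]
      monoidal

theorem one_braiding [BraidedCategory V] (A : V) [MonObj A] :
    (MonObj.one : 𝟙_ V ⟶ A) ▷ A ≫ (β_ A A).hom =
      (λ_ A).hom ≫ (ρ_ A).inv ≫ A ◁ (MonObj.one : 𝟙_ V ⟶ A) := by
  simp

theorem braiding_one [BraidedCategory V] (A : V) [MonObj A] :
    A ◁ (MonObj.one : 𝟙_ V ⟶ A) ≫ (β_ A A).hom =
      (ρ_ A).hom ≫ (λ_ A).inv ≫ (MonObj.one : 𝟙_ V ⟶ A) ▷ A := by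
  simp

theorem braiding_mul [BraidedCategory V] (A : V) [MonObj A] :
    A ◁ (MonObj.mul : A ⊗ A ⟶ A) ≫ (β_ A A).hom =
      (α_ A A A).inv ≫ (β_ A A).hom ▷ A ≫ (α_ A A A).hom ≫ A ◁ (β_ A A).hom ≫
        (α_ A A A).inv ≫ (MonObj.mul : A ⊗ A ⟶ A) ▷ A := by
  rw [BraidedCategory.braiding_naturality_right, BraidedCategory.braiding_tensor_right_hom]
  simp

theorem mul_braiding [BraidedCategory V] (A : V) [MonObj A] :
    (MonObj.mul : A ⊗ A ⟶ A) ▷ A ≫ (β_ A A).hom =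
      (α_ A A A).hom ≫ A ◁ (β_ A A).hom ≫ (α_ A A A).inv ≫ (β_ A A).hom ▷ A ≫
        (α_ A A A).hom ≫ A ◁ (MonObj.mul : A ⊗ A ⟶ A) := by
  rw [BraidedCategory.braiding_naturality_left, BraidedCategory.braiding_tensor_left_hom]
  simp

/-- The BD-law on `A ⊗ -` induced by the braiding `A ⊗ A ⟶ A ⊗ A`. -/
def leftBDLaw [BraidedCategory V] (A : V) [MonObj A] : BDLaw (leftMonad A) where
  law :=
    { app := fun X => (α_ A A X).inv ≫ (β_ A A).hom ▷ X ≫ (α_ A A X).hom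
      naturality := fun X Y f => by
        change A ◁ A ◁ f ≫ (α_ A A Y).inv ≫ (β_ A A).hom ▷ Y ≫ (α_ A A Y).hom =
          ((α_ A A X).inv ≫ (β_ A A).hom ▷ X ≫ (α_ A A X).hom) ≫ A ◁ A ◁ f
        trans (α_ A A X).inv ≫ ((A ⊗ A) ◁ f ≫ (β_ A A).hom ▷ Y) ≫ (α_ A A Y).hom
        · monoidal
        · rw [whisker_exchange]
          monoidal }
  unit_left := fun X => by
    have h := congrArg (fun f => f ▷ X) (one_braiding A)
    simp only [comp_whiskerRight] at h
    simp [leftMonad, reassoc_of% h]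
  unit_right := fun X => by
    change A ◁ ((λ_ X).inv ≫ (MonObj.one : 𝟙_ V ⟶ A) ▷ X) ≫
        (α_ A A X).inv ≫ (β_ A A).hom ▷ X ≫ (α_ A A X).hom =
      (λ_ (A ⊗ X)).inv ≫ (MonObj.one : 𝟙_ V ⟶ A) ▷ (A ⊗ X)
    trans A ◁ (λ_ X).inv ≫ (α_ A (𝟙_ V) X).inv ≫
        (A ◁ (MonObj.one : 𝟙_ V ⟶ A) ≫ (β_ A A).hom) ▷ X ≫ (α_ A A X).hom
    · monoidal
    · rw [braiding_one]
      monoidal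
  mul_right := fun X => by
    change A ◁ ((α_ A A X).inv ≫ (MonObj.mul : A ⊗ A ⟶ A) ▷ X) ≫
        (α_ A A X).inv ≫ (β_ A A).hom ▷ X ≫ (α_ A A X).hom =
      ((α_ A A (A ⊗ X)).inv ≫ (β_ A A).hom ▷ (A ⊗ X) ≫ (α_ A A (A ⊗ X)).hom) ≫
        A ◁ ((α_ A A X).inv ≫ (β_ A A).hom ▷ X ≫ (α_ A A X).hom) ≫
          (α_ A A (A ⊗ X)).inv ≫ (MonObj.mul : A ⊗ A ⟶ A) ▷ (A ⊗ X)
    trans A ◁ (α_ A A X).inv ≫ (α_ A (A ⊗ A) X).inv ≫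
        (A ◁ (MonObj.mul : A ⊗ A ⟶ A) ≫ (β_ A A).hom) ▷ X ≫ (α_ A A X).hom
    · monoidal
    · rw [braiding_mul]
      monoidal
  mul_left := fun X => by
    change ((α_ A A (A ⊗ X)).inv ≫ (MonObj.mul : A ⊗ A ⟶ A) ▷ (A ⊗ X)) ≫
        (α_ A A X).inv ≫ (β_ A A).hom ▷ X ≫ (α_ A A X).hom =
      A ◁ ((α_ A A X).inv ≫ (β_ A A).hom ▷ X ≫ (α_ A A X).hom) ≫
        ((α_ A A (A ⊗ X)).inv ≫ (β_ A A).hom ▷ (A ⊗ X) ≫ (α_ A A (A ⊗ X)).hom) ≫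
          A ◁ ((α_ A A X).inv ≫ (MonObj.mul : A ⊗ A ⟶ A) ▷ X)
    trans (α_ A A (A ⊗ X)).inv ≫ (α_ (A ⊗ A) A X).inv ≫
        ((MonObj.mul : A ⊗ A ⟶ A) ▷ A ≫ (β_ A A).hom) ▷ X ≫ (α_ A A X).hom
    · monoidal
    · rw [mul_braiding]
      monoidal
  yang_baxter := fun X => by
    change A ◁ ((α_ A A X).inv ≫ (β_ A A).hom ▷ X ≫ (α_ A A X).hom) ≫
        ((α_ A A (A ⊗ X)).inv ≫ (β_ A A).hom ▷ (A ⊗ X) ≫ (α_ A A (A ⊗ X)).hom) ≫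
          A ◁ ((α_ A A X).inv ≫ (β_ A A).hom ▷ X ≫ (α_ A A X).hom) =
      ((α_ A A (A ⊗ X)).inv ≫ (β_ A A).hom ▷ (A ⊗ X) ≫ (α_ A A (A ⊗ X)).hom) ≫
        A ◁ ((α_ A A X).inv ≫ (β_ A A).hom ▷ X ≫ (α_ A A X).hom) ≫
          (α_ A A (A ⊗ X)).inv ≫ (β_ A A).hom ▷ (A ⊗ X) ≫ (α_ A A (A ⊗ X)).hom
    have h := BraidedCategory.yang_baxter A A A
    trans A ◁ (α_ A A X).inv ≫ (α_ A (A ⊗ A) X).inv ≫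
        (A ◁ (β_ A A).hom ≫ (α_ A A A).inv ≫ (β_ A A).hom ▷ A ≫
          (α_ A A A).hom ≫ A ◁ (β_ A A).hom) ▷ X ≫
        (α_ A (A ⊗ A) X).hom ≫ A ◁ (α_ A A X).hom
    · monoidal
    · rw [← h]
      monoidal

/-- The algebra `A` is left Azumaya: the comparison functor of the monad `A ⊗ -`, with respect
to the BD-law given by the braiding, is an equivalence of categories. -/
def IsLeftAzumaya [BraidedCategory V] (A : V) [MonObj A] : Prop :=
  (leftBDLaw A).comparison.IsEquivalence

/-- The object `X` is finite: it has a left dual `D`, with unit `𝟙_ V ⟶ X ⊗ D` and counit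
`D ⊗ X ⟶ 𝟙_ V` satisfying the triangle identities. (Mathlib's class `HasRightDual`
names the duals with the opposite convention.) -/
def IsFiniteObject (X : V) : Prop :=
  ∃ D : V, Nonempty (ExactPairing X D)

end Algebras

end Azumaya

namespace Azumaya

section Finiteness

universe v u

variable {V : Type u} [Category.{v} V] [MonoidalCategory V]

/-! Write `T` for the enveloping monad and `K` for the comparison functor. As `K` is essentially
surjective, some `D` has `K D` isomorphic to the free module `T I`; this `D` will be the dual. The
coevaluation `c` is the unit `I ⟶ T I`, the free generator, carried to `A ⊗ D`. `T` acts on the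
left, so right tensoring by `A` preserves modules, and `K (D ⊗ A) ≅ T I ⊗ A ≅ T A`. Followed by the
action of `T` on `A`, this is a module map to `K I`, and fullness of `K` makes it `A ◁ e`. One
triangle is the unit law of the action (`unit_evaluationAction`). It forces the other zigzag `z : D
⟶ D` to satisfy `c ≫ A ◁ z = c` (`coevaluation_zigzag`). A module map out of a free module is
determined on the generator (`eq_of_unit_comp_eq`), so `K z = 𝟙`, and faithfulness gives `z = 𝟙`. -/

theorem coevaluation_zigzag {A D : V} (c : 𝟙_ V ⟶ A ⊗ D) (e : D ⊗ A ⟶ 𝟙_ V)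
    (h : c ▷ A ≫ (α_ A D A).hom ≫ A ◁ e = (λ_ A).hom ≫ (ρ_ A).inv) :
    c ≫ A ◁ ((ρ_ D).inv ≫ D ◁ c ≫ (α_ D A D).inv ≫ e ▷ D ≫ (λ_ D).hom) = c := by
  have h' := congrArg (fun f => f ▷ D) h
  simp only [comp_whiskerRight] at h'
  trans (ρ_ (𝟙_ V)).inv ≫ (c ▷ 𝟙_ V ≫ (A ⊗ D) ◁ c) ≫ (α_ A D (A ⊗ D)).hom ≫
      A ◁ (α_ D A D).inv ≫ A ◁ (e ▷ D) ≫ A ◁ (λ_ D).hom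
  · monoidal
  -- Interchanging the two copies of `c` brings one of them next to `e` in the shape of `h ▷ D`.
  rw [← whisker_exchange]
  trans (ρ_ (𝟙_ V)).inv ≫ 𝟙_ V ◁ c ≫ (α_ (𝟙_ V) A D).inv ≫
      (c ▷ A ▷ D ≫ (α_ A D A).hom ▷ D ≫ (A ◁ e) ▷ D) ≫ (α_ A (𝟙_ V) D).hom ≫ A ◁ (λ_ D).hom
  · monoidal
  rw [h']
  monoidal

/-! ### Right tensoring and the enveloping monad -/

/-- The right strength of the functor `A ⊗ (A ⊗ -)`. -/
def doubleStrength (A X Y : V) : (A ⊗ (A ⊗ X)) ⊗ Y ≅ A ⊗ (A ⊗ (X ⊗ Y)) :=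
  α_ A (A ⊗ X) Y ≪≫ whiskerLeftIso A (α_ A X Y)

variable [BraidedCategory V]

/-- The action of the enveloping monad of `A` on `A ⊗ X`. -/
def regularAction (A : V) [MonObj A] (X : V) : A ⊗ (A ⊗ (A ⊗ X)) ⟶ A ⊗ X :=
  ((leftBDLaw A).comparison.obj X).a

/-- The multiplication of the enveloping monad of `A`. -/
def envelopingMul (A : V) [MonObj A] (X : V) :
    A ⊗ (A ⊗ (A ⊗ (A ⊗ X))) ⟶ A ⊗ (A ⊗ X) :=
  (leftBDLaw A).enveloping.μ.app X

/-- The unit of the enveloping monad of `A`. -/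
def envelopingUnit (A : V) [MonObj A] (X : V) : X ⟶ A ⊗ (A ⊗ X) :=
  (leftBDLaw A).enveloping.η.app X

variable (A : V) [MonObj A]

/-- The action involves only the `A` factors on the left, so once it is unfolded only coherence
remains. -/
theorem regularAction_whiskerRight (X Y : V) :
    regularAction A X ▷ Y ≫ (α_ A X Y).hom =
      (doubleStrength A (A ⊗ X) Y).hom ≫ A ◁ A ◁ (α_ A X Y).hom ≫
        regularAction A (X ⊗ Y) := by
  change (A ◁ ((α_ A A X).inv ≫ (β_ A A).hom ▷ X ≫ (α_ A A X).hom) ≫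
      A ◁ ((α_ A A X).inv ≫ (MonObj.mul : A ⊗ A ⟶ A) ▷ X) ≫
        (α_ A A X).inv ≫ (MonObj.mul : A ⊗ A ⟶ A) ▷ X) ▷ Y ≫ (α_ A X Y).hom =
    ((α_ A (A ⊗ (A ⊗ X)) Y).hom ≫ A ◁ (α_ A (A ⊗ X) Y).hom) ≫ A ◁ A ◁ (α_ A X Y).hom ≫
      A ◁ ((α_ A A (X ⊗ Y)).inv ≫ (β_ A A).hom ▷ (X ⊗ Y) ≫ (α_ A A (X ⊗ Y)).hom) ≫
      A ◁ ((α_ A A (X ⊗ Y)).inv ≫ (MonObj.mul : A ⊗ A ⟶ A) ▷ (X ⊗ Y)) ≫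
        (α_ A A (X ⊗ Y)).inv ≫ (MonObj.mul : A ⊗ A ⟶ A) ▷ (X ⊗ Y)
  monoidal

theorem envelopingMul_whiskerRight (X Y : V) :
    envelopingMul A X ▷ Y ≫ (doubleStrength A X Y).hom =
      (doubleStrength A (A ⊗ (A ⊗ X)) Y).hom ≫ A ◁ A ◁ (doubleStrength A X Y).hom ≫
        envelopingMul A (X ⊗ Y) := by
  change (A ◁ ((α_ A A (A ⊗ X)).inv ≫ (β_ A A).hom ▷ (A ⊗ X) ≫ (α_ A A (A ⊗ X)).hom) ≫
      ((α_ A A (A ⊗ (A ⊗ X))).inv ≫ (MonObj.mul : A ⊗ A ⟶ A) ▷ (A ⊗ (A ⊗ X))) ≫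
        A ◁ (((α_ A A X).inv ≫ (β_ A A).hom ▷ X ≫ (α_ A A X).hom) ≫
          (α_ A A X).inv ≫ (MonObj.mul : A ⊗ A ⟶ A) ▷ X)) ▷ Y ≫
      (α_ A (A ⊗ X) Y).hom ≫ A ◁ (α_ A X Y).hom =
    ((α_ A (A ⊗ (A ⊗ (A ⊗ X))) Y).hom ≫ A ◁ (α_ A (A ⊗ (A ⊗ X)) Y).hom) ≫
      A ◁ A ◁ ((α_ A (A ⊗ X) Y).hom ≫ A ◁ (α_ A X Y).hom) ≫
      A ◁ ((α_ A A (A ⊗ (X ⊗ Y))).inv ≫ (β_ A A).hom ▷ (A ⊗ (X ⊗ Y)) ≫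
        (α_ A A (A ⊗ (X ⊗ Y))).hom) ≫
      ((α_ A A (A ⊗ (A ⊗ (X ⊗ Y)))).inv ≫
        (MonObj.mul : A ⊗ A ⟶ A) ▷ (A ⊗ (A ⊗ (X ⊗ Y)))) ≫
        A ◁ (((α_ A A (X ⊗ Y)).inv ≫ (β_ A A).hom ▷ (X ⊗ Y) ≫ (α_ A A (X ⊗ Y)).hom) ≫
          (α_ A A (X ⊗ Y)).inv ≫ (MonObj.mul : A ⊗ A ⟶ A) ▷ (X ⊗ Y))
  monoidal

theorem envelopingUnit_whiskerRight (X Y : V) :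
    envelopingUnit A X ▷ Y ≫ (doubleStrength A X Y).hom = envelopingUnit A (X ⊗ Y) := by
  change ((((λ_ X).inv ≫ (MonObj.one : 𝟙_ V ⟶ A) ▷ X) ≫
      (λ_ (A ⊗ X)).inv ≫ (MonObj.one : 𝟙_ V ⟶ A) ▷ (A ⊗ X))) ▷ Y ≫
        (α_ A (A ⊗ X) Y).hom ≫ A ◁ (α_ A X Y).hom =
    ((λ_ (X ⊗ Y)).inv ≫ (MonObj.one : 𝟙_ V ⟶ A) ▷ (X ⊗ Y)) ≫
      (λ_ (A ⊗ (X ⊗ Y))).inv ≫ (MonObj.one : 𝟙_ V ⟶ A) ▷ (A ⊗ (X ⊗ Y))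
  monoidal

theorem envelopingUnit_naturality {X Y : V} (f : X ⟶ Y) :
    f ≫ envelopingUnit A Y = envelopingUnit A X ≫ A ◁ A ◁ f :=
  (leftBDLaw A).enveloping.η.naturality f

theorem envelopingMul_naturality {X Y : V} (f : X ⟶ Y) :
    A ◁ A ◁ A ◁ A ◁ f ≫ envelopingMul A Y = envelopingMul A X ≫ A ◁ A ◁ f :=
  (leftBDLaw A).enveloping.μ.naturality f

theorem envelopingUnit_mul (X : V) :
    A ◁ A ◁ envelopingUnit A X ≫ envelopingMul A X = 𝟙 _ :=
  (leftBDLaw A).enveloping.right_unit X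

theorem envelopingUnit_regularAction (X : V) :
    envelopingUnit A (A ⊗ X) ≫ regularAction A X = 𝟙 _ :=
  ((leftBDLaw A).comparison.obj X).unit

theorem envelopingMul_regularAction (X : V) :
    envelopingMul A (A ⊗ X) ≫ regularAction A X =
      A ◁ A ◁ regularAction A X ≫ regularAction A X :=
  ((leftBDLaw A).comparison.obj X).assoc

theorem whiskerLeft_regularAction {X Y : V} (f : X ⟶ Y) :
    A ◁ A ◁ A ◁ f ≫ regularAction A Y = regularAction A X ≫ A ◁ f :=
  ((leftBDLaw A).comparison.map f).h

/-! ### Evaluation and the free generator -/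

variable {A}

/-- Right tensoring of an isomorphism from `A ⊗ D` to the free module on the unit object,
followed by the action of the enveloping monad on `A`. -/
def evaluationAction {D : V} (φ : A ⊗ D ⟶ A ⊗ (A ⊗ 𝟙_ V)) : A ⊗ (D ⊗ A) ⟶ A ⊗ 𝟙_ V :=
  (α_ A D A).inv ≫ φ ▷ A ≫ (doubleStrength A (𝟙_ V) A).hom ≫
    A ◁ A ◁ ((λ_ A).hom ≫ (ρ_ A).inv) ≫ regularAction A (𝟙_ V)

/-- Every factor is a module map: the strengths by compatibility with right tensoring, `φ ▷ A` by
`hφ`, the final action by associativity. -/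
theorem evaluationAction_linear {D : V} (φ : A ⊗ D ⟶ A ⊗ (A ⊗ 𝟙_ V))
    (hφ : A ◁ A ◁ φ ≫ envelopingMul A (𝟙_ V) = regularAction A D ≫ φ) :
    A ◁ A ◁ evaluationAction φ ≫ regularAction A (𝟙_ V) =
      regularAction A (D ⊗ A) ≫ evaluationAction φ := by
  have h1 : regularAction A (D ⊗ A) ≫ (α_ A D A).inv =
      A ◁ A ◁ (α_ A D A).inv ≫ (doubleStrength A (A ⊗ D) A).inv ≫ regularAction A D ▷ A := by
    rw [Iso.comp_inv_eq, Category.assoc, Category.assoc, regularAction_whiskerRight]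
    simp
  have h2 : (doubleStrength A (A ⊗ D) A).inv ≫ (A ◁ A ◁ φ) ▷ A =
      A ◁ A ◁ (φ ▷ A) ≫ (doubleStrength A (A ⊗ (A ⊗ 𝟙_ V)) A).inv := by
    simp [doubleStrength]
  have h3 := congrArg (fun f => f ▷ A) hφ
  simp only [comp_whiskerRight] at h3
  simp only [evaluationAction, MonoidalCategory.whiskerLeft_comp, Category.assoc]
  rw [reassoc_of% h1, ← reassoc_of% h3, reassoc_of% h2,
    reassoc_of% (envelopingMul_whiskerRight A (𝟙_ V) A), Iso.inv_hom_id_assoc,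
    ← envelopingMul_regularAction]
  have h4 := envelopingMul_naturality A ((λ_ A).hom ≫ (ρ_ A).inv)
  simp only [MonoidalCategory.whiskerLeft_comp, Category.assoc] at h4
  rw [reassoc_of% h4]

theorem eq_of_unit_comp_eq {D X : V} (φ : A ⊗ D ≅ A ⊗ (A ⊗ 𝟙_ V))
    (hφ : A ◁ A ◁ φ.hom ≫ envelopingMul A (𝟙_ V) = regularAction A D ≫ φ.hom)
    {f g : D ⟶ X}
    (h : (envelopingUnit A (𝟙_ V) ≫ φ.inv) ≫ A ◁ f =
      (envelopingUnit A (𝟙_ V) ≫ φ.inv) ≫ A ◁ g) :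
    A ◁ f = A ◁ g := by
  -- The free extension formula: the module map `φ.inv ≫ A ◁ k` is rebuilt from its value on the
  -- generator.
  have key (k : D ⟶ X) : φ.inv ≫ A ◁ k =
      A ◁ A ◁ ((envelopingUnit A (𝟙_ V) ≫ φ.inv) ≫ A ◁ k) ≫ regularAction A X := by
    have h1 : envelopingMul A (𝟙_ V) ≫ φ.inv = A ◁ A ◁ φ.inv ≫ regularAction A D := by
      rw [Iso.comp_inv_eq, Category.assoc, ← hφ]
      simp [← MonoidalCategory.whiskerLeft_comp_assoc]
    simp only [MonoidalCategory.whiskerLeft_comp, Category.assoc]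
    rw [whiskerLeft_regularAction, ← reassoc_of% h1, reassoc_of% (envelopingUnit_mul A (𝟙_ V))]
  rw [← cancel_epi φ.inv, key, key, h]

theorem unit_evaluationAction {D : V} (φ : A ⊗ D ≅ A ⊗ (A ⊗ 𝟙_ V)) :
    (envelopingUnit A (𝟙_ V) ≫ φ.inv) ▷ A ≫ (α_ A D A).hom ≫ evaluationAction φ.hom =
      (λ_ A).hom ≫ (ρ_ A).inv := by
  have h1 := envelopingUnit_naturality A ((λ_ A).hom ≫ (ρ_ A).inv)
  simp only [evaluationAction, comp_whiskerRight, Category.assoc, Iso.hom_inv_id_assoc,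
    inv_hom_whiskerRight_assoc]
  rw [reassoc_of% (envelopingUnit_whiskerRight A (𝟙_ V) A), ← reassoc_of% h1,
    envelopingUnit_regularAction, Category.comp_id]

theorem IsLeftAzumaya.isFiniteObject (hA : IsLeftAzumaya A) : IsFiniteObject A := by
  have : (leftBDLaw A).comparison.IsEquivalence := hA
  let K := (leftBDLaw A).comparison
  let D : V := K.objPreimage ((leftBDLaw A).enveloping.free.obj (𝟙_ V))
  let ψ : K.obj D ≅ (leftBDLaw A).enveloping.free.obj (𝟙_ V) := K.objObjPreimageIso _
  let φ : A ⊗ D ≅ A ⊗ (A ⊗ 𝟙_ V) := (leftBDLaw A).enveloping.forget.mapIso ψ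
  have hφ : A ◁ A ◁ φ.hom ≫ envelopingMul A (𝟙_ V) = regularAction A D ≫ φ.hom := ψ.hom.h
  let g : K.obj (D ⊗ A) ⟶ K.obj (𝟙_ V) :=
    { f := evaluationAction φ.hom
      h := evaluationAction_linear φ.hom hφ }
  let c : 𝟙_ V ⟶ A ⊗ D := envelopingUnit A (𝟙_ V) ≫ φ.inv
  let e : D ⊗ A ⟶ 𝟙_ V := K.preimage g
  have he : A ◁ e = evaluationAction φ.hom := congrArg Monad.Algebra.Hom.f (K.map_preimage g)
  have h1 : c ▷ A ≫ (α_ A D A).hom ≫ A ◁ e = (λ_ A).hom ≫ (ρ_ A).inv := by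
    rw [he]
    exact unit_evaluationAction φ
  have h2 : (ρ_ D).inv ≫ D ◁ c ≫ (α_ D A D).inv ≫ e ▷ D ≫ (λ_ D).hom = 𝟙 D := by
    -- Faithfulness of `K` reduces the second triangle to a comparison on the generator `c`.
    refine K.map_injective (Monad.Algebra.Hom.ext (eq_of_unit_comp_eq φ hφ ?_))
    rw [MonoidalCategory.whiskerLeft_id, Category.comp_id]
    exact coevaluation_zigzag c e h1
  refine ⟨D, ⟨⟨c, e, ?_, h1⟩⟩⟩
  rw [Iso.inv_comp_eq, Category.comp_id] at h2
  rw [← h2]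
  simp

end Finiteness

end Azumaya

theorem mainTheorem8 {V : Type*} [Category V] [MonoidalCategory V] [BraidedCategory V]
    (A : V) [MonObj A] (hA : Azumaya.IsLeftAzumaya A) :
    Azumaya.IsFiniteObject A :=
  hA.isFiniteObject
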